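/- Let $v_0(n)$ denote the coefficients in the power series expansion $$\sum_{n=0}^\infty v_0(n)q^n=\sum_{n=0}^\infty \frac{q^{n^2}(-q;q^2)_n}{(q;q^2)_n},\qquad (a;q)_n=\prod_{i=1}^n(1-aq^{i-1}),\quad (a;q)_0=1,$$ so that the right-hand side equals $\frac{V_0(q)+1}{2}$, where $V_0(q)$ is the eighth order mock theta function of Gordon and McIntosh. Then for every integer $n\ge 0$ and every $r\in\{132,164,228,292,356,388\}$, $$v_0(416n+r)\equiv 0\pmod{13}.$$ -/

import Mathlib

open scoped PowerSeries.WithPiTopology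

/-- The finite `q`-Pochhammer symbol `(a; q)_n = ∏_{i=1}^n (1 - a q^{i-1})` for formal power
series `a` and `q` with integer coefficients. -/
noncomputable def qPochhammer (a q : PowerSeries ℤ) (n : ℕ) : PowerSeries ℤ :=
  ∏ i ∈ Finset.range n, (1 - a * q ^ i)

/-- The `k`-th summand `q^{k^2} (-q; q^2)_k / (q; q^2)_k`, the variable `q` being
`PowerSeries.X`. The denominator has constant coefficient `1`, and
`PowerSeries.invOfUnit _ 1` is its inverse in `ℤ⟦q⟧` (see `qPochhammer_mul_invOfUnit`). -/
noncomputable def v0Term (k : ℕ) : PowerSeries ℤ :=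
  PowerSeries.X ^ (k ^ 2) * qPochhammer (-PowerSeries.X) (PowerSeries.X ^ 2) k *
    PowerSeries.invOfUnit (qPochhammer PowerSeries.X (PowerSeries.X ^ 2) k) 1

/-- `v_0(n)`: the coefficient of `q^n` in `∑_{k ≥ 0} q^{k^2} (-q; q^2)_k / (q; q^2)_k`.
Summands with `k > n` do not contribute (see `coeff_v0Term_eq_zero`), so the coefficient is a
finite sum; `hasSum_v0Term` is the resulting identity of power series. -/
noncomputable def v0 (n : ℕ) : ℤ :=
  ∑ k ∈ Finset.range (n + 1), PowerSeries.coeff n (v0Term k)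

theorem qPochhammer_mul_invOfUnit (k : ℕ) :
    qPochhammer PowerSeries.X (PowerSeries.X ^ 2) k *
      PowerSeries.invOfUnit (qPochhammer PowerSeries.X (PowerSeries.X ^ 2) k) 1 = 1 := by
  apply PowerSeries.mul_invOfUnit
  simp [qPochhammer, map_prod]

theorem coeff_v0Term_eq_zero {n k : ℕ} (h : n < k) : PowerSeries.coeff n (v0Term k) = 0 := by
  rw [v0Term, mul_assoc, PowerSeries.coeff_X_pow_mul', if_neg]
  have : k ≤ k ^ 2 := Nat.le_self_pow two_ne_zero k
  omega

theorem hasSum_v0Term : HasSum v0Term (PowerSeries.mk v0) := by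
  rw [PowerSeries.WithPiTopology.hasSum_iff_hasSum_coeff]
  intro n
  rw [PowerSeries.coeff_mk, v0]
  apply hasSum_sum_of_ne_finset_zero
  intro k hk
  exact coeff_v0Term_eq_zero (by simpa using hk)

/-! Write φ, ψ for Ramanujan's theta functions and E(q) = ∏(1 - q^n).

Even part. Multiplied by (-q;q²)_∞ (q;q²)_∞, the n-th summand becomes, by Euler's expansions, the
double sum over i, j of the terms `tripleTerm (n, i, j)`. Negative n gives the same series at -q, so
the sum over n ∈ ℤ sees only even powers of q. Summed over n before i and j, the terms depend on i +
j except for an alternating convolution, which vanishes for odd i + j (`altConv_odd`,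
`altConv_even`). The result is 2 ∑ v0(2n) q^n - 1 = φ(q)² / φ(-q²) (`v0Even_mul_evalNegHom_phi`).

Dissection. The 2-dissection of φ² gives 2 ∑ v0(4n) q^n - 1 = φ(q)² / φ(-q). With the denominator
made a series in q^8, the exponents 1 mod 8 yield ∑ v0(32n + 4) q^n, and Jacobi's identity φ(q)^4 -
φ(-q)^4 = 16 q ψ(q²)^4 turns it into 3 ψ(q) + 512 q E(q) (E(q²) / φ(-q))^13 (`v0ThirtyTwo_mul`).

Modulo 13 the 13th power is a series in q^13. A surviving exponent n therefore has 8n + 1 = (2t -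
1)² from ψ, or 3(8n + 1) ≡ (6k - 1)² from q E(q). As 3 ≡ 4² is a square, 8n + 1 is a square modulo
13 either way. The six values r = 32m + 4 are those for which 8m + 1 is a nonresidue, and 416 = 32 ·
13. -/

namespace EighthOrderMockTheta

open PowerSeries Filter Topology Finset

/-! ### Convergence of formal power series -/

theorem summable_of_X_pow_dvd {ι : Type*} {f : ι → ℤ⟦X⟧} (u : ι → ℕ)
    (hu : ∀ d, {i | u i ≤ d}.Finite) (hf : ∀ i, X ^ u i ∣ f i) : Summable f := by
  rw [WithPiTopology.summable_iff_summable_coeff]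
  intro d
  refine summable_of_ne_finset_zero (s := (hu d).toFinset) fun i hi => ?_
  exact X_pow_dvd_iff.mp (hf i) d (by simpa using hi)

theorem hasSum_of_hasSum_succ {f : ℕ → ℤ⟦X⟧} {S : ℤ⟦X⟧} (h0 : f 0 = 0)
    (h : HasSum (fun j => f (j + 1)) S) : HasSum f S := by
  simpa [h0] using h.zero_add

theorem tendsto_zero_iff {F : ℕ → ℤ⟦X⟧} :
    Tendsto F atTop (𝓝 0) ↔ ∀ d, ∀ᶠ n in atTop, X ^ d ∣ F n := by
  rw [WithPiTopology.tendsto_iff_coeff_tendsto]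
  simp only [map_zero, nhds_discrete, tendsto_pure, X_pow_dvd_iff]
  constructor
  · intro h d
    exact (Set.finite_Iio d).eventually_all.mpr fun i _ => h i
  · intro h d
    filter_upwards [h (d + 1)] with n hn using hn d (Nat.lt_succ_self d)

theorem tendsto_mul_zero {F : ℕ → ℤ⟦X⟧} (hF : Tendsto F atTop (𝓝 0)) (G : ℕ → ℤ⟦X⟧) :
    Tendsto (fun n => G n * F n) atTop (𝓝 0) := by
  rw [tendsto_zero_iff] at hF ⊢
  intro d
  filter_upwards [hF d] with n hn using hn.mul_left _

/-- Dominated convergence in the q-adic topology: `u` bounds all orders of vanishing uniformly in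
`n`, so each coefficient is a sum over one fixed finite set. -/
theorem tendsto_of_hasSum {ι : Type*} {f : ℕ → ι → ℤ⟦X⟧} {g : ι → ℤ⟦X⟧} {F : ℕ → ℤ⟦X⟧}
    {G : ℤ⟦X⟧} (u : ι → ℕ) (hu : ∀ d, {i | u i ≤ d}.Finite) (hfu : ∀ n i, X ^ u i ∣ f n i)
    (hgu : ∀ i, X ^ u i ∣ g i) (hfg : ∀ i, Tendsto (fun n => f n i) atTop (𝓝 (g i)))
    (hF : ∀ n, HasSum (f n) (F n)) (hG : HasSum g G) : Tendsto F atTop (𝓝 G) := by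
  have key : ∀ (h : ι → ℤ⟦X⟧) (H : ℤ⟦X⟧), HasSum h H → (∀ i, X ^ u i ∣ h i) → ∀ d,
      coeff d H = ∑ i ∈ (hu d).toFinset, coeff d (h i) := by
    intro h H hH hh d
    refine ((WithPiTopology.hasSum_iff_hasSum_coeff _ |>.mp hH) d).unique ?_
    exact hasSum_sum_of_ne_finset_zero fun i hi =>
      X_pow_dvd_iff.mp (hh i) d (by simpa using hi)
  rw [WithPiTopology.tendsto_iff_coeff_tendsto]
  intro d
  rw [key g G hG hgu d]
  simp_rw [fun n => key (f n) (F n) (hF n) (hfu n) d]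
  exact tendsto_finsetSum _ fun i _ =>
    (WithPiTopology.tendsto_iff_coeff_tendsto _ _ _ _ |>.mp (hfg i)) d

theorem tendsto_X_pow {e : ℕ → ℕ} (he : ∀ n, n ≤ e n) :
    Tendsto (fun n => (X : ℤ⟦X⟧) ^ e n) atTop (𝓝 0) := by
  rw [tendsto_zero_iff]
  intro d
  filter_upwards [eventually_ge_atTop d] with n hn using pow_dvd_pow _ (hn.trans (he n))

theorem continuous_expand (k : ℕ) (hk : k ≠ 0) :
    Continuous (expand k hk : ℤ⟦X⟧ → ℤ⟦X⟧) := by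
  rw [continuous_iff_continuousAt]
  intro F
  rw [ContinuousAt, WithPiTopology.tendsto_iff_coeff_tendsto]
  intro d
  simp only [coeff_expand]
  split_ifs
  · exact (WithPiTopology.continuous_coeff ℤ _).continuousAt
  · exact tendsto_const_nhds

theorem continuous_evalNegHom : Continuous (evalNegHom : ℤ⟦X⟧ → ℤ⟦X⟧) := by
  rw [continuous_iff_continuousAt]
  intro F
  rw [ContinuousAt, WithPiTopology.tendsto_iff_coeff_tendsto]
  intro d
  simp only [evalNegHom, coeff_rescale]
  exact ((WithPiTopology.continuous_coeff ℤ _).continuousAt).const_mul _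

theorem expand_injective (k : ℕ) (hk : k ≠ 0) :
    Function.Injective (expand k hk : ℤ⟦X⟧ → ℤ⟦X⟧) := by
  intro F G h
  ext n
  rw [← coeff_expand_mul k hk F n, h, coeff_expand_mul]

theorem evalNegHom_expand_two (F : ℤ⟦X⟧) :
    evalNegHom (expand 2 two_ne_zero F) = expand 2 two_ne_zero F := by
  ext n
  rw [evalNegHom, coeff_rescale, coeff_expand]
  split_ifs with h
  · rw [Even.neg_one_pow (even_iff_two_dvd.mpr h), one_mul]
  · simp

theorem evalNegHom_evalNegHom (F : ℤ⟦X⟧) : evalNegHom (evalNegHom F) = F := by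
  ext n
  simp only [evalNegHom, coeff_rescale]
  rw [← mul_assoc, ← mul_pow]
  simp

/-! ### Reciprocals of `q`-factorials -/

/-- The finite product `(q^a; q^a)_j`. -/
noncomputable def qFact (a j : ℕ) : ℤ⟦X⟧ := ∏ i ∈ range j, (1 - X ^ (a * (i + 1)))

/-- The reciprocal `1 / (q^a; q^a)_j`. -/
noncomputable def qFactInv (a j : ℕ) : ℤ⟦X⟧ := invOfUnit (qFact a j) 1

theorem constantCoeff_qFact {a : ℕ} (ha : a ≠ 0) (j : ℕ) : constantCoeff (qFact a j) = 1 := by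
  simp [qFact, map_prod, ha]

theorem qFact_mul_qFactInv {a : ℕ} (ha : a ≠ 0) (j : ℕ) : qFact a j * qFactInv a j = 1 :=
  mul_invOfUnit _ _ (by simp [constantCoeff_qFact ha])

theorem qFact_ne_zero {a : ℕ} (ha : a ≠ 0) (j : ℕ) : qFact a j ≠ 0 :=
  left_ne_zero_of_mul_eq_one (qFact_mul_qFactInv ha j)

theorem qFactInv_zero {a : ℕ} (ha : a ≠ 0) : qFactInv a 0 = 1 := by
  simpa [qFact] using qFact_mul_qFactInv ha 0

theorem one_sub_mul_qFactInv_succ {a : ℕ} (ha : a ≠ 0) (j : ℕ) :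
    (1 - X ^ (a * (j + 1))) * qFactInv a (j + 1) = qFactInv a j := by
  apply mul_left_cancel₀ (qFact_ne_zero ha j)
  have h := qFact_mul_qFactInv ha (j + 1)
  rw [qFact, prod_range_succ, mul_assoc] at h
  rw [qFact_mul_qFactInv ha]
  exact h

theorem expand_qFact (k a j : ℕ) (hk : k ≠ 0) : expand k hk (qFact a j) = qFact (k * a) j := by
  simp [qFact, map_prod, ← pow_mul, mul_assoc]

theorem expand_qFactInv (k : ℕ) {a : ℕ} (j : ℕ) (hk : k ≠ 0) (ha : a ≠ 0) :
    expand k hk (qFactInv a j) = qFactInv (k * a) j := by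
  apply mul_left_cancel₀ (qFact_ne_zero (mul_ne_zero hk ha) j)
  rw [qFact_mul_qFactInv (mul_ne_zero hk ha), ← expand_qFact k a j hk, ← map_mul,
    qFact_mul_qFactInv ha, map_one]

theorem evalNegHom_qFactInv_two (j : ℕ) : evalNegHom (qFactInv 2 j) = qFactInv 2 j := by
  rw [show qFactInv 2 j = expand 2 two_ne_zero (qFactInv 1 j) from
    (expand_qFactInv 2 j two_ne_zero one_ne_zero).symm, evalNegHom_expand_two]

/-- The alternating convolution `∑_{i+j=N} (-1)^i / ((q²; q²)_i (q²; q²)_j)`. -/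
noncomputable def altConv (N : ℕ) : ℤ⟦X⟧ :=
  ∑ p ∈ antidiagonal N, (-1) ^ p.1 * (qFactInv 2 p.1 * qFactInv 2 p.2)

/-- For i + j = N + 2, split 1 - q^(2(i+j)) = (1 - q^(2i)) + q^(2i) (1 - q^(2j)); each factor
cancels the last factor of a q-factorial and lowers an index. In generating functions this reflects
(z;q²)_∞ (-z;q²)_∞ = (z²;q⁴)_∞. -/
theorem one_sub_mul_altConv (N : ℕ) :
    (1 - X ^ (2 * (N + 2))) * altConv (N + 2) = altConv N := by
  have h2 : (2 : ℕ) ≠ 0 := two_ne_zero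
  have hA : ∀ N, ∑ p ∈ antidiagonal (N + 1),
      (-1) ^ p.1 * ((1 - X ^ (2 * p.1)) * (qFactInv 2 p.1 * qFactInv 2 p.2)) = -altConv N := by
    intro N
    rw [Nat.sum_antidiagonal_succ, altConv, ← sum_neg_distrib]
    simp only [mul_zero, pow_zero, sub_self, zero_mul, zero_add]
    refine sum_congr rfl fun p _ => ?_
    rw [← one_sub_mul_qFactInv_succ h2 p.1]
    ring
  have hB : ∑ p ∈ antidiagonal (N + 2), (-1) ^ p.1 * (X ^ (2 * p.1) * (1 - X ^ (2 * p.2)) *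
      (qFactInv 2 p.1 * qFactInv 2 p.2)) = altConv (N + 1) + altConv N := by
    have h1 : altConv (N + 1) + altConv N = ∑ p ∈ antidiagonal (N + 1),
        (-1) ^ p.1 * (X ^ (2 * p.1) * (qFactInv 2 p.1 * qFactInv 2 p.2)) := by
      rw [← neg_eq_iff_eq_neg.mpr (hA N), altConv, ← sub_eq_add_neg, ← sum_sub_distrib]
      refine sum_congr rfl fun p _ => ?_
      ring
    rw [h1, Nat.sum_antidiagonal_succ']
    simp only [mul_zero, pow_zero, sub_self, zero_mul, zero_add]
    refine sum_congr rfl fun p _ => ?_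
    rw [← one_sub_mul_qFactInv_succ h2 p.2]
    ring
  have hs : (1 - X ^ (2 * (N + 2))) * altConv (N + 2) = -altConv (N + 1) +
      (altConv (N + 1) + altConv N) := by
    rw [← hB, ← hA (N + 1), altConv, mul_sum, ← sum_add_distrib]
    refine sum_congr rfl fun p hp => ?_
    rw [← mem_antidiagonal.mp hp]
    ring
  rw [hs]
  ring

theorem one_sub_X_pow_ne_zero {k : ℕ} (hk : k ≠ 0) : (1 - X ^ k : ℤ⟦X⟧) ≠ 0 := by
  intro h
  have := congrArg (constantCoeff (R := ℤ)) h
  simp [hk] at this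

theorem altConv_odd (M : ℕ) : altConv (2 * M + 1) = 0 := by
  induction M with
  | zero => simp [altConv, Nat.sum_antidiagonal_succ, mul_comm]
  | succ M ih =>
    have h := one_sub_mul_altConv (2 * M + 1)
    rw [ih] at h
    exact (mul_eq_zero.mp h).resolve_left (one_sub_X_pow_ne_zero (by omega))

theorem altConv_even (M : ℕ) : altConv (2 * M) = qFactInv 4 M := by
  induction M with
  | zero => simp [altConv, qFactInv_zero]
  | succ M ih =>
    have h := one_sub_mul_altConv (2 * M)
    rw [ih, ← one_sub_mul_qFactInv_succ four_ne_zero M,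
      show 2 * (2 * M + 2) = 4 * (M + 1) by ring] at h
    exact mul_left_cancel₀ (one_sub_X_pow_ne_zero (by omega)) h

/-! ### The Jacobi triple product -/

/-- `x t = a t (t - 1) / 2 + b t`, the exponents in the bilateral theta series attached to the
products of `1 + q^(a i + b)` and `1 + q^(a i + b')`, where `b + b' = a`. -/
structure ThetaExponent (a b b' : ℕ) (x : ℤ → ℕ) : Prop where
  ne_zero : a ≠ 0
  add_eq : b + b' = a
  two_mul_eq : ∀ t, 2 * (x t : ℤ) = a * (t * (t - 1)) + 2 * b * t
  natAbs_le : ∀ t, t.natAbs ≤ x t + 1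

/-- The bilateral theta series `∑_{t ∈ ℤ} q^(x t)`. -/
noncomputable def thetaSeries (x : ℤ → ℕ) : ℤ⟦X⟧ := ∑' t, X ^ x t

/-- `∑_{j ≥ 0} q^(x (j - n)) / (q^a; q^a)_j`. -/
noncomputable def lowerSeries (a : ℕ) (x : ℤ → ℕ) (n : ℕ) : ℤ⟦X⟧ :=
  ∑' j : ℕ, X ^ x (j - n) * qFactInv a j

/-- `∑_{j ≥ 0} q^(x j + a n j) / (q^a; q^a)_j`. -/
noncomputable def upperSeries (a : ℕ) (x : ℤ → ℕ) (n : ℕ) : ℤ⟦X⟧ :=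
  ∑' j : ℕ, X ^ (x j + a * n * j) * qFactInv a j

theorem upperSeries_zero : upperSeries a x 0 = lowerSeries a x 0 := by
  simp [upperSeries, lowerSeries]

namespace ThetaExponent

variable {a b b' : ℕ} {x : ℤ → ℕ} (hx : ThetaExponent a b b' x)
include hx

theorem finite_le (d : ℕ) : {t | x t ≤ d}.Finite := by
  refine (Set.finite_Icc (-(d + 1 : ℤ)) (d + 1)).subset fun t ht => ?_
  have := hx.natAbs_le t
  simp only [Set.mem_ofPred_eq] at ht
  simp only [Set.mem_Icc]
  omega

theorem finite_le_sub (n d : ℕ) : {j : ℕ | x (j - n) ≤ d}.Finite :=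
  (hx.finite_le d).preimage (f := fun j : ℕ => (j : ℤ) - n) fun i _ j _ h => by
    simpa using h

theorem hasSum_thetaSeries : HasSum (fun t => (X : ℤ⟦X⟧) ^ x t) (thetaSeries x) :=
  (summable_of_X_pow_dvd x hx.finite_le fun _ => dvd_rfl).hasSum

theorem hasSum_lowerSeries (n : ℕ) :
    HasSum (fun j : ℕ => X ^ x (j - n) * qFactInv a j) (lowerSeries a x n) :=
  (summable_of_X_pow_dvd _ (hx.finite_le_sub n) fun _ => dvd_mul_right _ _).hasSum

theorem hasSum_upperSeries (n : ℕ) :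
    HasSum (fun j : ℕ => X ^ (x j + a * n * j) * qFactInv a j) (upperSeries a x n) := by
  refine (summable_of_X_pow_dvd (fun j : ℕ => x ((j : ℤ) - (0 : ℕ))) (hx.finite_le_sub 0)
    fun j => ?_).hasSum
  rw [pow_add, mul_assoc]
  simp

/-- In the difference of the two series the exponents differ by a j, so a factor 1 - q^(a j)
appears; it cancels against the q-factorial, and shifting j returns the series for n. -/
theorem lowerSeries_succ (n : ℕ) :
    lowerSeries a x (n + 1) = (1 + X ^ (a * n + b')) * lowerSeries a x n := by
  have h1 := (hx.hasSum_lowerSeries (n + 1)).sub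
    ((hx.hasSum_lowerSeries n).mul_left (X ^ (a * n + b')))
  have h2 : HasSum (fun j : ℕ => (X : ℤ⟦X⟧) ^ x (j - (n + 1 : ℕ)) * qFactInv a j -
      X ^ (a * n + b') * (X ^ x (j - n) * qFactInv a j)) (lowerSeries a x n) := by
    have he : ∀ j : ℕ, (X : ℤ⟦X⟧) ^ x (j - (n + 1 : ℕ)) * qFactInv a j -
        X ^ (a * n + b') * (X ^ x (j - n) * qFactInv a j) =
        X ^ x (j - (n + 1 : ℕ)) * ((1 - X ^ (a * j)) * qFactInv a j) := by
      intro j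
      have : x (j - n) + (a * n + b') = x (j - (n + 1 : ℕ)) + a * j := by
        have h1 := hx.two_mul_eq (j - n)
        have h2 := hx.two_mul_eq (j - (n + 1 : ℕ))
        have h3 : (b : ℤ) + b' = a := by exact_mod_cast hx.add_eq
        zify
        push_cast at h1 h2 ⊢
        rw [← h3] at h1 h2 ⊢
        linarith
      rw [← mul_assoc, ← pow_add, add_comm (a * n + b'), this]
      ring
    simp_rw [he]
    refine hasSum_of_hasSum_succ (by simp) ((hx.hasSum_lowerSeries n).congr_fun fun j => ?_)
    rw [one_sub_mul_qFactInv_succ hx.ne_zero]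
    push_cast
    rw [show (j : ℤ) + 1 - (n + 1) = j - n by ring]
  have h3 := h1.unique h2
  linear_combination h3

theorem upperSeries_eq_mul_succ (n : ℕ) :
    upperSeries a x n = (1 + X ^ (a * n + b)) * upperSeries a x (n + 1) := by
  have h1 := (hx.hasSum_upperSeries n).sub (hx.hasSum_upperSeries (n + 1))
  have h2 : HasSum (fun j : ℕ => (X : ℤ⟦X⟧) ^ (x j + a * n * j) * qFactInv a j -
      X ^ (x j + a * (n + 1) * j) * qFactInv a j)
      (X ^ (a * n + b) * upperSeries a x (n + 1)) := by
    have he : ∀ j : ℕ, (X : ℤ⟦X⟧) ^ (x j + a * n * j) * qFactInv a j -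
        X ^ (x j + a * (n + 1) * j) * qFactInv a j =
        X ^ (x j + a * n * j) * ((1 - X ^ (a * j)) * qFactInv a j) := by
      intro j
      ring
    simp_rw [he]
    refine hasSum_of_hasSum_succ (by simp)
      (((hx.hasSum_upperSeries (n + 1)).mul_left (X ^ (a * n + b))).congr_fun fun j => ?_)
    have : x (j + 1 : ℕ) + a * n * (j + 1) = a * n + b + (x j + a * (n + 1) * j) := by
      have h1 := hx.two_mul_eq j
      have h2 := hx.two_mul_eq (j + 1 : ℕ)
      zify
      push_cast at h1 h2 ⊢
      linarith
    rw [one_sub_mul_qFactInv_succ hx.ne_zero, this, pow_add, mul_assoc]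
  have h3 := h1.unique h2
  linear_combination h3

theorem lowerSeries_eq_prod_mul (n : ℕ) :
    lowerSeries a x n = (∏ i ∈ range n, (1 + X ^ (a * i + b'))) * lowerSeries a x 0 := by
  induction n with
  | zero => simp
  | succ n ih => rw [hx.lowerSeries_succ, ih, prod_range_succ]; ring

theorem lowerSeries_zero_eq_prod_mul (n : ℕ) :
    lowerSeries a x 0 = (∏ i ∈ range n, (1 + X ^ (a * i + b))) * upperSeries a x n := by
  induction n with
  | zero => simp [upperSeries_zero]
  | succ n ih => rw [ih, prod_range_succ, hx.upperSeries_eq_mul_succ]; ring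

theorem apply_zero : x 0 = 0 := by
  have := hx.two_mul_eq 0
  simpa using this

theorem tendsto_upperSeries : Tendsto (upperSeries a x) atTop (𝓝 1) := by
  refine tendsto_of_hasSum (g := fun j : ℕ => if j = 0 then 1 else 0)
    (fun j : ℕ => x ((j : ℤ) - (0 : ℕ))) (hx.finite_le_sub 0) (fun n j => ?_) (fun j => ?_)
    (fun j => ?_) hx.hasSum_upperSeries (hasSum_ite_eq 0 1)
  · rw [pow_add, mul_assoc]
    simp
  · split_ifs with h
    · simp [h, hx.apply_zero]
    · exact dvd_zero _
  · split_ifs with h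
    · simp [h, hx.apply_zero, qFactInv_zero hx.ne_zero]
    · simp_rw [mul_comm _ (qFactInv a j)]
      refine tendsto_mul_zero (tendsto_X_pow fun n => ?_) _
      have : 0 < a * j := Nat.mul_pos (Nat.pos_of_ne_zero hx.ne_zero) (Nat.pos_of_ne_zero h)
      nlinarith

theorem lowerSeries_zero_eq_of_hasProd {P : ℤ⟦X⟧}
    (hP : HasProd (fun i : ℕ => (1 + X ^ (a * i + b) : ℤ⟦X⟧)) P) : lowerSeries a x 0 = P := by
  have h := hP.tendsto_prod_nat.mul hx.tendsto_upperSeries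
  simp_rw [← hx.lowerSeries_zero_eq_prod_mul, mul_one] at h
  exact tendsto_nhds_unique tendsto_const_nhds h

/-- With t = j - n the sum runs over t ≥ -n, and 1 / (q^a; q^a)_(t+n) tends to 1 / E for fixed t,
leaving the bilateral series. -/
theorem tendsto_lowerSeries_mul {E : ℤ⟦X⟧} (hE : Tendsto (qFact a) atTop (𝓝 E)) :
    Tendsto (fun n => lowerSeries a x n * E) atTop (𝓝 (thetaSeries x)) := by
  have hone : Tendsto (fun j => qFactInv a j * E) atTop (𝓝 1) := by
    have h0 : Tendsto (fun j => E - qFact a j) atTop (𝓝 0) := by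
      simpa using (tendsto_const_nhds (x := E)).sub hE
    have h1 := (tendsto_mul_zero h0 (qFactInv a)).add_const 1
    rw [zero_add] at h1
    refine h1.congr fun j => ?_
    linear_combination -qFact_mul_qFactInv hx.ne_zero j
  refine tendsto_of_hasSum (f := fun n t => if -(n : ℤ) ≤ t then
      X ^ x t * (qFactInv a (t + n).toNat * E) else 0) x hx.finite_le (fun n t => ?_)
    (fun t => dvd_rfl) (fun t => ?_) (fun n => ?_) hx.hasSum_thetaSeries
  · split_ifs
    · exact dvd_mul_right _ _
    · exact dvd_zero _
  · have h2 : Tendsto (fun n : ℕ => (t + n).toNat) atTop atTop :=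
      tendsto_atTop_atTop.mpr fun d => ⟨d + t.natAbs, fun n hn => by omega⟩
    have h3 := (hone.comp h2).const_mul (X ^ x t)
    rw [mul_one] at h3
    refine h3.congr' ?_
    filter_upwards [eventually_ge_atTop t.natAbs] with n hn
    rw [if_pos (by omega)]
    rfl
  · have hinj : Function.Injective (fun j : ℕ => (j : ℤ) - n) := fun i j h => by simpa using h
    rw [← hinj.hasSum_iff]
    · refine ((hx.hasSum_lowerSeries n).mul_right E).congr_fun ?_
      intro j
      simp [mul_assoc]
    · intro t ht
      refine if_neg fun h => ht ⟨(t + n).toNat, ?_⟩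
      simp only
      omega

/-- The **Jacobi triple product** identity. -/
theorem thetaSeries_eq {P P' E : ℤ⟦X⟧}
    (hP : HasProd (fun i : ℕ => (1 + X ^ (a * i + b) : ℤ⟦X⟧)) P)
    (hP' : HasProd (fun i : ℕ => (1 + X ^ (a * i + b') : ℤ⟦X⟧)) P')
    (hE : HasProd (fun i : ℕ => (1 - X ^ (a * (i + 1)) : ℤ⟦X⟧)) E) :
    thetaSeries x = P * P' * E := by
  have h := (hP'.tendsto_prod_nat.mul_const (lowerSeries a x 0)).mul_const E
  simp_rw [← hx.lowerSeries_eq_prod_mul] at h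
  rw [tendsto_nhds_unique (hx.tendsto_lowerSeries_mul hE.tendsto_prod_nat) h,
    hx.lowerSeries_zero_eq_of_hasProd hP]
  ring

end ThetaExponent

/-! ### Infinite products and Ramanujan's theta functions -/

theorem multipliable_one_add_X_pow {e : ℕ → ℕ} (he : ∀ n, n ≤ e n) :
    Multipliable fun n => (1 + X ^ e n : ℤ⟦X⟧) := by
  refine WithPiTopology.multipliable_one_add_of_tendsto_order_atTop_nhds_top ℤ ?_
  simp_rw [order_X_pow]
  exact ENat.tendsto_natCast_nhds_top.comp (tendsto_atTop_mono he tendsto_id)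

/-- The exponents `t²` of the theta function `φ`. -/
def sqExp (t : ℤ) : ℕ := t.natAbs ^ 2

/-- The exponents `t (t - 1) / 2` of the theta function `2 ψ`. -/
def triExp (t : ℤ) : ℕ := (t * (t - 1) / 2).toNat

theorem natCast_sqExp (t : ℤ) : (sqExp t : ℤ) = t ^ 2 := by simp [sqExp]

theorem two_mul_natCast_triExp (t : ℤ) : 2 * (triExp t : ℤ) = t * (t - 1) := by
  have h2 : 2 ∣ t * (t - 1) := by
    have := Int.even_mul_pred_self t
    exact this.two_dvd
  have h0 : 0 ≤ t * (t - 1) := by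
    rcases le_or_gt t 0 with h | h <;> nlinarith
  rw [triExp]
  omega

theorem thetaExponent_sqExp : ThetaExponent 2 1 1 sqExp where
  ne_zero := two_ne_zero
  add_eq := rfl
  two_mul_eq t := by rw [natCast_sqExp]; push_cast; ring
  natAbs_le t := by rw [sqExp]; nlinarith [Nat.le_self_pow two_ne_zero t.natAbs]

theorem thetaExponent_triExp : ThetaExponent 1 0 1 triExp where
  ne_zero := one_ne_zero
  add_eq := rfl
  two_mul_eq t := by rw [two_mul_natCast_triExp]; push_cast; ring
  -- The slack 1 in the bound is needed here: the exponent vanishes at t = 1.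
  natAbs_le t := by
    have := two_mul_natCast_triExp t
    zify
    rcases abs_cases t with ⟨h, _⟩ | ⟨h, _⟩ <;> rw [h] <;> nlinarith

/-- Ramanujan's theta function `φ(q) = ∑_{t ∈ ℤ} q^(t²)`. -/
noncomputable def phi : ℤ⟦X⟧ := thetaSeries sqExp

/-- Euler's product `∏_{n ≥ 1} (1 - q^n)`. -/
noncomputable def euler : ℤ⟦X⟧ := pentagonalSeries ℤ

/-- The product `∏_{n ≥ 1} (1 + q^n)`. -/
noncomputable def distinctProd : ℤ⟦X⟧ := ∏' n : ℕ, (1 + X ^ (n + 1))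

/-- The product `∏_{n ≥ 0} (1 + q^(2 n + 1))`. -/
noncomputable def oddProd : ℤ⟦X⟧ := ∏' n : ℕ, (1 + X ^ (2 * n + 1))

/-- Ramanujan's theta function `ψ(q) = ∑_{n ≥ 0} q^(n (n + 1) / 2)`, as a product. -/
noncomputable def psi : ℤ⟦X⟧ := euler * distinctProd ^ 2

theorem hasProd_euler : HasProd (fun n : ℕ => (1 - X ^ (n + 1) : ℤ⟦X⟧)) euler :=
  WithPiTopology.hasProd_one_sub_X_pow ℤ

theorem hasProd_distinctProd : HasProd (fun n : ℕ => (1 + X ^ (n + 1) : ℤ⟦X⟧)) distinctProd :=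
  (multipliable_one_add_X_pow fun n => Nat.le_succ n).hasProd

theorem hasProd_oddProd : HasProd (fun n : ℕ => (1 + X ^ (2 * n + 1) : ℤ⟦X⟧)) oddProd :=
  (multipliable_one_add_X_pow fun n => by omega).hasProd

theorem hasProd_evalNegHom_oddProd :
    HasProd (fun n : ℕ => (1 - X ^ (2 * n + 1) : ℤ⟦X⟧)) (evalNegHom oddProd) := by
  refine (hasProd_oddProd.map evalNegHom continuous_evalNegHom).congr_fun fun n => ?_
  simp [evalNegHom_X, Odd.neg_pow ⟨n, rfl⟩, sub_eq_add_neg]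

theorem hasProd_expand_euler :
    HasProd (fun n : ℕ => (1 - X ^ (2 * (n + 1)) : ℤ⟦X⟧)) (expand 2 two_ne_zero euler) := by
  refine (hasProd_euler.map _ (continuous_expand 2 two_ne_zero)).congr_fun fun n => ?_
  simp [pow_mul]

theorem evalNegHom_oddProd_mul_expand_euler :
    evalNegHom oddProd * expand 2 two_ne_zero euler = euler := by
  refine HasProd.unique (HasProd.even_mul_odd ?_ ?_) hasProd_euler
  · exact hasProd_evalNegHom_oddProd
  · exact hasProd_expand_euler

theorem oddProd_mul_evalNegHom_oddProd :
    oddProd * evalNegHom oddProd = expand 2 two_ne_zero (evalNegHom oddProd) := by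
  refine (hasProd_oddProd.mul hasProd_evalNegHom_oddProd).unique
    ((hasProd_evalNegHom_oddProd.map _ (continuous_expand 2 two_ne_zero)).congr_fun fun n => ?_)
  simp only [Function.comp_apply, map_sub, map_one, map_pow, expand_X]
  ring

theorem distinctProd_mul_euler : distinctProd * euler = expand 2 two_ne_zero euler := by
  refine (hasProd_distinctProd.mul hasProd_euler).unique
    (hasProd_expand_euler.congr_fun fun n => ?_)
  ring

theorem euler_ne_zero : euler ≠ 0 := by
  intro h
  have := coeff_pentagonalSeries_pentagonal ℤ 0
  rw [← euler, h] at this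
  simp at this

theorem expand_ne_zero {F : ℤ⟦X⟧} (hF : F ≠ 0) (k : ℕ) (hk : k ≠ 0) : expand k hk F ≠ 0 :=
  (map_ne_zero_iff _ (expand_injective k hk)).mpr hF

theorem phi_eq : phi = oddProd ^ 2 * expand 2 two_ne_zero euler := by
  rw [phi, thetaExponent_sqExp.thetaSeries_eq hasProd_oddProd hasProd_oddProd
    hasProd_expand_euler, sq]

theorem thetaSeries_triExp : thetaSeries triExp = 2 * psi := by
  -- The factor at n = 0 is 1 + q^0 = 2: each triangular number occurs for two values of t.
  have h0 : HasProd (fun n : ℕ => (1 + X ^ (1 * n + 0) : ℤ⟦X⟧)) (2 * distinctProd) := by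
    convert HasProd.zero_mul (f := fun n : ℕ => (1 + X ^ (1 * n + 0) : ℤ⟦X⟧))
      (m := distinctProd) ?_ using 2
    · norm_num
    · simpa using hasProd_distinctProd
  rw [thetaExponent_triExp.thetaSeries_eq h0 (P' := distinctProd) (E := euler)
    (by simpa using hasProd_distinctProd) (by simpa using hasProd_euler), psi]
  ring

theorem evalNegHom_phi :
    evalNegHom phi = evalNegHom oddProd ^ 2 * expand 2 two_ne_zero euler := by
  rw [phi_eq, map_mul, map_pow, evalNegHom_expand_two]

theorem evalNegHom_phi_mul_expand_euler :
    evalNegHom phi * expand 2 two_ne_zero euler = euler ^ 2 := by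
  rw [evalNegHom_phi]
  linear_combination (evalNegHom oddProd * expand 2 two_ne_zero euler + euler) *
    evalNegHom_oddProd_mul_expand_euler

theorem psi_mul_euler : psi * euler = expand 2 two_ne_zero euler ^ 2 := by
  rw [← distinctProd_mul_euler, psi]
  ring

theorem phi_mul_evalNegHom_phi :
    phi * evalNegHom phi = expand 2 two_ne_zero (evalNegHom phi) ^ 2 := by
  have h := congrArg (expand 2 two_ne_zero) evalNegHom_oddProd_mul_expand_euler
  rw [map_mul] at h
  rw [evalNegHom_phi, phi_eq, map_mul, map_pow, ← oddProd_mul_evalNegHom_oddProd]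
  rw [← oddProd_mul_evalNegHom_oddProd] at h
  linear_combination -(oddProd * evalNegHom oddProd) ^ 2 * (oddProd * evalNegHom oddProd *
    expand 2 two_ne_zero (expand 2 two_ne_zero euler) + expand 2 two_ne_zero euler) * h

theorem psi_sq : psi ^ 2 = phi * expand 2 two_ne_zero psi := by
  have h1 := evalNegHom_oddProd_mul_expand_euler
  have h2 := congrArg (expand 2 two_ne_zero) h1
  have h3 := distinctProd_mul_euler
  have h4 := congrArg (expand 2 two_ne_zero) h3
  rw [map_mul, ← oddProd_mul_evalNegHom_oddProd] at h2
  rw [map_mul] at h4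
  rw [phi_eq, psi, map_mul, map_pow]
  generalize expand 2 two_ne_zero (expand 2 two_ne_zero euler) = E4 at *
  generalize expand 2 two_ne_zero distinctProd = D2 at *
  have h5 : oddProd * E4 * euler = expand 2 two_ne_zero euler ^ 2 := by
    linear_combination -oddProd * E4 * h1 + expand 2 two_ne_zero euler * h2
  apply mul_left_cancel₀ (pow_ne_zero 2 euler_ne_zero)
  calc euler ^ 2 * (euler * distinctProd ^ 2) ^ 2 = (distinctProd * euler) ^ 4 := by ring
    _ = (oddProd * E4 * euler) ^ 2 := by rw [h3, h5]; ring
    _ = _ := by rw [← h4]; ring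

/-! ### The even part of the generating function of `v0` -/

/-- The summands `(-1)^i q^((i + n)² + (j - n)²) / ((q²; q²)_i (q²; q²)_j)`. -/
noncomputable def tripleTerm (p : ℤ × ℕ × ℕ) : ℤ⟦X⟧ :=
  X ^ (sqExp (p.2.1 + p.1) + sqExp (p.2.2 - p.1)) *
    ((-1) ^ p.2.1 * (qFactInv 2 p.2.1 * qFactInv 2 p.2.2))

/-- Since i, j ≥ 0 and i + j = (i + n) + (j - n), bounding the two squares bounds i and j, hence n.
-/
theorem summable_tripleTerm : Summable tripleTerm := by
  refine summable_of_X_pow_dvd (fun p : ℤ × ℕ × ℕ => sqExp (p.2.1 + p.1) + sqExp (p.2.2 - p.1))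
    (fun d => ?_) fun p => dvd_mul_right _ _
  refine (((Set.finite_Icc (-(4 * d + 4 : ℤ)) (4 * d + 4)).prod
    ((Set.finite_Iic (4 * d + 4)).prod (Set.finite_Iic (4 * d + 4))))).subset fun p hp => ?_
  obtain ⟨n, i, j⟩ := p
  simp only [Set.mem_ofPred_eq] at hp
  have h1 := thetaExponent_sqExp.natAbs_le (i + n)
  have h2 := thetaExponent_sqExp.natAbs_le (j - n)
  simp only [Set.mem_prod, Set.mem_Icc, Set.mem_Iic]
  omega

theorem oddProd_eq : lowerSeries 2 sqExp 0 = oddProd :=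
  thetaExponent_sqExp.lowerSeries_zero_eq_of_hasProd hasProd_oddProd

theorem neg_one_pow_sqExp (t : ℤ) : ((-1 : ℤ⟦X⟧)) ^ sqExp t = (-1) ^ t.natAbs := by
  rw [sqExp, pow_two, pow_mul]
  rcases Nat.even_or_odd t.natAbs with h | h
  · simp [h.neg_one_pow]
  · simp [h.neg_one_pow]

theorem v0Term_mul (n : ℕ) : v0Term n * (oddProd * evalNegHom oddProd) =
    X ^ (n ^ 2) * evalNegHom (upperSeries 2 sqExp n) * lowerSeries 2 sqExp n := by
  have h1 := thetaExponent_sqExp.lowerSeries_eq_prod_mul n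
  have h2 := congrArg evalNegHom (thetaExponent_sqExp.lowerSeries_zero_eq_prod_mul n)
  have h3 : qPochhammer (-X) (X ^ 2) n = ∏ i ∈ range n, (1 + X ^ (2 * i + 1) : ℤ⟦X⟧) := by
    refine prod_congr rfl fun i _ => ?_
    ring
  have h4 : qPochhammer X (X ^ 2) n =
      evalNegHom (∏ i ∈ range n, (1 + X ^ (2 * i + 1) : ℤ⟦X⟧)) := by
    rw [qPochhammer, map_prod]
    refine prod_congr rfl fun i _ => ?_
    simp only [map_add, map_one, map_pow, evalNegHom_X, Odd.neg_pow ⟨i, rfl⟩]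
    ring
  have h5 := qPochhammer_mul_invOfUnit n
  rw [oddProd_eq] at h1 h2
  rw [map_mul, ← h4] at h2
  rw [h1, h2, v0Term, ← h3]
  linear_combination X ^ (n ^ 2) * qPochhammer (-X) (X ^ 2) n * oddProd *
    evalNegHom (upperSeries 2 sqExp n) * h5

theorem hasSum_tripleTerm_natCast (n : ℕ) : HasSum (fun p : ℕ × ℕ => tripleTerm (n, p))
    (v0Term n * (oddProd * evalNegHom oddProd)) := by
  have hM := ((thetaExponent_sqExp.hasSum_upperSeries n).map _ continuous_evalNegHom).mul_left
    (X ^ (n ^ 2))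
  have hL := thetaExponent_sqExp.hasSum_lowerSeries n
  have he : ∀ p : ℕ × ℕ, tripleTerm (n, p) = X ^ (n ^ 2) *
      (evalNegHom ∘ fun j : ℕ => X ^ (sqExp j + 2 * n * j) * qFactInv 2 j) p.1 *
      (X ^ sqExp (p.2 - n) * qFactInv 2 p.2) := by
    rintro ⟨i, j⟩
    have h1 : n ^ 2 + (sqExp i + 2 * n * i) = sqExp (i + n) := by
      zify
      simp only [natCast_sqExp]
      ring
    have h2 : (-1 : ℤ⟦X⟧) ^ (sqExp i + 2 * n * i) = (-1) ^ i := by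
      rw [pow_add, neg_one_pow_sqExp, mul_assoc, pow_mul]
      simp
    simp only [tripleTerm, Function.comp_apply, map_mul, map_pow, evalNegHom_X,
      evalNegHom_qFactInv_two]
    rw [neg_pow X, h2, pow_add, ← h1, pow_add]
    ring
  rw [v0Term_mul]
  refine (hM.mul hL ?_).congr_fun he
  exact (summable_tripleTerm.comp_injective (i := fun p : ℕ × ℕ => ((n : ℤ), p))
    fun p q h => (Prod.mk.inj h).2).congr he

/-- Exchanging i and j restores the exponent but turns (-1)^i into (-1)^j. The exponent has the
parity of i + j, so q ↦ -q supplies the missing sign. -/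
theorem hasSum_tripleTerm_neg (n : ℕ) : HasSum (fun p : ℕ × ℕ => tripleTerm (-n, p))
    (evalNegHom (v0Term n * (oddProd * evalNegHom oddProd))) := by
  refine ((Equiv.prodComm ℕ ℕ).hasSum_iff.mpr ((hasSum_tripleTerm_natCast n).map _
    continuous_evalNegHom)).congr_fun ?_
  rintro ⟨i, j⟩
  simp only [tripleTerm, Function.comp_apply, Equiv.prodComm_apply, Prod.swap_prod_mk, map_mul,
    map_pow, map_neg, map_one, evalNegHom_X, evalNegHom_qFactInv_two]
  rw [neg_pow X, pow_add (-1 : ℤ⟦X⟧), neg_one_pow_sqExp, neg_one_pow_sqExp, ← pow_add]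
  have h1 : sqExp (i + -n) + sqExp (j - -n) = sqExp (j + n) + sqExp (i - n) := by
    rw [sub_neg_eq_add, ← sub_eq_add_neg, add_comm]
  have h2 : (-1 : ℤ⟦X⟧) ^ ((j + n : ℤ).natAbs + (i - n : ℤ).natAbs) * (-1) ^ j = (-1) ^ i := by
    rw [← pow_add]
    rcases Nat.even_or_odd i with h | h
    · rw [h.neg_one_pow, Even.neg_one_pow]
      grind
    · rw [h.neg_one_pow, Odd.neg_one_pow]
      grind
  rw [h1, ← h2]
  ring

theorem hasSum_tripleTerm : HasSum tripleTerm
    (PowerSeries.mk v0 * (oddProd * evalNegHom oddProd) +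
      evalNegHom (PowerSeries.mk v0 * (oddProd * evalNegHom oddProd)) -
      oddProd * evalNegHom oddProd) := by
  have h0 := summable_tripleTerm.hasSum.prod_fiberwise
    fun n => (summable_tripleTerm.prod_factor n).hasSum
  have h1 := hasSum_v0Term.mul_right (oddProd * evalNegHom oddProd)
  have h2 := h1.map _ continuous_evalNegHom
  -- The term n = 0 lies in both halves and is subtracted once; the zeroth summand of the v0 series
  -- is 1.
  have h3 := HasSum.of_nat_of_neg (f := fun n : ℤ => ∑' p, tripleTerm (n, p))
    (h1.congr_fun fun n => (hasSum_tripleTerm_natCast n).tsum_eq)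
    (h2.congr_fun fun n => (hasSum_tripleTerm_neg n).tsum_eq)
  have h4 := (hasSum_tripleTerm_natCast 0).tsum_eq
  rw [Nat.cast_zero] at h4
  rw [h4, v0Term] at h3
  simp only [qPochhammer, range_zero, prod_empty] at h3
  have h5 : invOfUnit (1 : ℤ⟦X⟧) 1 = 1 := by
    simpa using mul_invOfUnit (1 : ℤ⟦X⟧) 1 (by simp)
  rw [h5] at h3
  simp only [ne_eq, OfNat.ofNat_ne_zero, not_false_eq_true, zero_pow, pow_zero, one_mul] at h3
  rw [← h0.unique h3]
  exact summable_tripleTerm.hasSum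

/-- `∑_{t ∈ ℤ} q^(t² + (N - t)²)`. -/
noncomputable def pairTheta (N : ℕ) : ℤ⟦X⟧ := ∑' t : ℤ, X ^ (sqExp t + sqExp (N - t))

theorem hasSum_pairTheta (N : ℕ) :
    HasSum (fun t : ℤ => (X : ℤ⟦X⟧) ^ (sqExp t + sqExp (N - t))) (pairTheta N) :=
  (summable_of_X_pow_dvd sqExp thetaExponent_sqExp.finite_le
    fun _ => pow_dvd_pow _ (Nat.le_add_right _ _)).hasSum

theorem pairTheta_even (M : ℕ) :
    pairTheta (2 * M) = X ^ (2 * M ^ 2) * expand 2 two_ne_zero phi := by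
  -- Centring t at M: (M + s)² + (M - s)² = 2M² + 2s².
  have h := (Equiv.addLeft (M : ℤ)).hasSum_iff.mpr (hasSum_pairTheta (2 * M))
  refine h.unique ?_
  refine ((thetaExponent_sqExp.hasSum_thetaSeries.map _
    (continuous_expand 2 two_ne_zero)).mul_left (X ^ (2 * M ^ 2))).congr_fun fun t => ?_
  simp only [Function.comp_apply, Equiv.coe_addLeft, map_pow, expand_X, ← pow_mul, ← pow_add]
  congr 1
  zify
  simp only [natCast_sqExp]
  ring

theorem hasSum_tripleTerm_fiber (p : ℕ × ℕ) : HasSum (fun n : ℤ => tripleTerm (n, p))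
    (pairTheta (p.1 + p.2) * ((-1) ^ p.1 * (qFactInv 2 p.1 * qFactInv 2 p.2))) := by
  refine (((Equiv.addLeft (p.1 : ℤ)).hasSum_iff.mpr
    (hasSum_pairTheta (p.1 + p.2))).mul_right _).congr_fun fun n => ?_
  simp only [tripleTerm, Function.comp_apply, Equiv.coe_addLeft]
  rw [show ((p.1 + p.2 : ℕ) : ℤ) - (p.1 + n) = p.2 - n by push_cast; ring]

theorem hasSum_pairTheta_mul_altConv :
    HasSum (fun N => pairTheta N * altConv N) (∑' p, tripleTerm p) := by
  have h1 := ((Equiv.prodComm (ℕ × ℕ) ℤ).hasSum_iff.mpr summable_tripleTerm.hasSum).prod_fiberwise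
    hasSum_tripleTerm_fiber
  have h2 := (HasAntidiagonal.sigmaAntidiagonalEquivProd (A := ℕ)).hasSum_iff.mpr h1
  refine h2.sigma fun N => ?_
  rw [altConv, mul_sum]
  refine (Finset.hasSum (antidiagonal N) (fun p : ℕ × ℕ => pairTheta N *
    ((-1) ^ p.1 * (qFactInv 2 p.1 * qFactInv 2 p.2)))).congr_fun ?_
  rintro ⟨p, hp⟩
  simp [HasAntidiagonal.sigmaAntidiagonalEquivProd, mem_antidiagonal.mp hp]

theorem hasSum_pairTheta_mul_altConv_eq_phi :
    HasSum (fun N => pairTheta N * altConv N)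
      (expand 2 two_ne_zero phi * expand 2 two_ne_zero oddProd) := by
  have hinj : Function.Injective fun M : ℕ => 2 * M := fun i j h => by simpa using h
  rw [← hinj.hasSum_iff]
  · rw [← oddProd_eq]
    refine (((thetaExponent_sqExp.hasSum_lowerSeries 0).map _
      (continuous_expand 2 two_ne_zero)).mul_left (expand 2 two_ne_zero phi)).congr_fun
      fun M => ?_
    simp only [Function.comp_apply, pairTheta_even, altConv_even, map_mul, map_pow, expand_X,
      expand_qFactInv 2 M two_ne_zero two_ne_zero, Nat.cast_zero, sub_zero, ← pow_mul]
    simp only [sqExp, Int.natAbs_natCast]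
    ring
  · intro N hN
    obtain ⟨M, rfl | rfl⟩ := Nat.even_or_odd' N
    · exact absurd ⟨M, rfl⟩ hN
    · rw [altConv_odd, mul_zero]

/-- The generating function of the numbers `v0 (2 n)`. -/
noncomputable def v0Even : ℤ⟦X⟧ := PowerSeries.mk fun n => v0 (2 * n)

theorem mk_v0_add_evalNegHom :
    PowerSeries.mk v0 + evalNegHom (PowerSeries.mk v0) = 2 * expand 2 two_ne_zero v0Even := by
  ext n
  rw [map_add, evalNegHom, coeff_rescale, coeff_mk, two_mul, map_add, coeff_expand, v0Even,
    coeff_mk]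
  split_ifs with h
  · rw [Even.neg_one_pow (even_iff_two_dvd.mpr h), Nat.mul_div_cancel' h]
    ring
  · rw [Odd.neg_one_pow (Nat.not_even_iff_odd.mp (even_iff_two_dvd.not.mpr h))]
    ring

theorem v0Even_mul : (2 * v0Even - 1) * evalNegHom oddProd = phi * oddProd := by
  apply expand_injective 2 two_ne_zero
  have h1 := hasSum_tripleTerm.tsum_eq ▸ hasSum_pairTheta_mul_altConv
  have h2 := h1.unique hasSum_pairTheta_mul_altConv_eq_phi
  rw [map_mul, map_mul evalNegHom oddProd, evalNegHom_evalNegHom] at h2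
  simp only [map_mul, map_sub, map_one, map_ofNat, ← oddProd_mul_evalNegHom_oddProd]
  linear_combination h2 - oddProd * evalNegHom oddProd * mk_v0_add_evalNegHom

theorem v0Even_mul_evalNegHom_phi :
    (2 * v0Even - 1) * expand 2 two_ne_zero (evalNegHom phi) = phi ^ 2 := by
  have h := congrArg (expand 2 two_ne_zero) evalNegHom_oddProd_mul_expand_euler
  rw [map_mul, ← oddProd_mul_evalNegHom_oddProd] at h
  rw [evalNegHom_phi, map_mul, map_pow, ← oddProd_mul_evalNegHom_oddProd, sq phi]
  nth_rw 2 [phi_eq]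
  linear_combination (2 * v0Even - 1) * (oddProd * evalNegHom oddProd) * h +
    oddProd * expand 2 two_ne_zero euler * v0Even_mul

/-! ### Dissections -/

theorem expand_expand {a b c : ℕ} (ha : a ≠ 0) (hb : b ≠ 0) (hc : c ≠ 0) (h : a * b = c)
    (F : ℤ⟦X⟧) : expand a ha (expand b hb F) = expand c hc F := by
  subst h
  exact (expand_mul a ha b hb F).symm

theorem evalNegHom_expand_even {c : ℕ} (hc : c ≠ 0) (h : Even c) (F : ℤ⟦X⟧) :
    evalNegHom (expand c hc F) = expand c hc F := by
  obtain ⟨b, rfl⟩ := h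
  rw [← expand_expand two_ne_zero (by omega : b ≠ 0) hc (two_mul b), evalNegHom_expand_two]

theorem phi_dissection :
    phi = expand 4 four_ne_zero phi + 2 * X * expand 8 (by norm_num) psi := by
  have heven : HasSum (fun t : ℤ => if Even t then (X : ℤ⟦X⟧) ^ sqExp t else 0)
      (expand 4 four_ne_zero phi) := by
    have hinj : Function.Injective fun t : ℤ => 2 * t := fun i j h => by simpa using h
    rw [← hinj.hasSum_iff]
    · refine (thetaExponent_sqExp.hasSum_thetaSeries.map _
        (continuous_expand 4 four_ne_zero)).congr_fun fun t => ?_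
      simp only [Function.comp_apply, even_two_mul, if_true, map_pow, expand_X, ← pow_mul]
      congr 1
      zify
      simp only [natCast_sqExp]
      ring
    · intro t ht
      refine if_neg fun h => ht ?_
      obtain ⟨s, rfl⟩ := h
      exact ⟨s, two_mul s⟩
  have hodd : HasSum (fun t : ℤ => if Even t then 0 else (X : ℤ⟦X⟧) ^ sqExp t)
      (X * expand 8 (by norm_num) (thetaSeries triExp)) := by
    have hinj : Function.Injective fun t : ℤ => 2 * t - 1 := fun i j h => by simpa using h
    rw [← hinj.hasSum_iff]
    · refine ((thetaExponent_triExp.hasSum_thetaSeries.map _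
        (continuous_expand 8 (by norm_num))).mul_left X).congr_fun fun t => ?_
      have hne : ¬ Even (2 * t - 1) := by grind
      simp only [Function.comp_apply, if_neg hne, map_pow, expand_X, ← pow_mul, ← pow_succ']
      congr 1
      zify
      rw [natCast_sqExp]
      linear_combination -4 * two_mul_natCast_triExp t
    · intro t ht
      refine if_pos ?_
      by_contra h
      obtain ⟨s, rfl⟩ := Int.not_even_iff_odd.mp h
      exact ht ⟨s + 1, by ring⟩
  have h := (heven.add hodd).congr_fun (g := fun t : ℤ => (X : ℤ⟦X⟧) ^ sqExp t) fun t => by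
    split_ifs <;> simp
  rw [thetaSeries_triExp, map_mul, map_ofNat] at h
  have h' := thetaExponent_sqExp.hasSum_thetaSeries.unique h
  rw [← phi] at h'
  linear_combination h'

/-- At q² this is φ(-q²)² = φ(q) φ(-q), with both factors split into even and odd parts by
`phi_dissection`. -/
theorem evalNegHom_phi_sq :
    evalNegHom phi ^ 2 =
      expand 2 two_ne_zero phi ^ 2 - 4 * X * expand 4 four_ne_zero psi ^ 2 := by
  apply expand_injective 2 two_ne_zero
  have h1 := phi_mul_evalNegHom_phi
  have h2 := congrArg evalNegHom phi_dissection
  simp only [map_add, map_mul, map_ofNat, evalNegHom_X, evalNegHom_expand_even four_ne_zero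
    (by decide), evalNegHom_expand_even (show 8 ≠ 0 by norm_num) (by decide)] at h2
  simp only [map_sub, map_mul, map_pow, expand_X, map_ofNat,
    expand_expand two_ne_zero two_ne_zero four_ne_zero rfl,
    expand_expand two_ne_zero four_ne_zero (show 8 ≠ 0 by norm_num) rfl]
  linear_combination -h1 + phi * h2 + (expand 4 four_ne_zero phi -
    2 * X * expand 8 (by norm_num) psi) * phi_dissection

theorem phi_sq :
    phi ^ 2 = expand 2 two_ne_zero phi ^ 2 + 4 * X * expand 4 four_ne_zero psi ^ 2 := by
  have h := congrArg evalNegHom evalNegHom_phi_sq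
  simp only [map_sub, map_mul, map_pow, map_ofNat, evalNegHom_X, evalNegHom_expand_two,
    evalNegHom_evalNegHom, evalNegHom_expand_even four_ne_zero (by decide)] at h
  linear_combination h

theorem phi_pow_four_sub :
    phi ^ 4 - evalNegHom phi ^ 4 = 16 * X * expand 2 two_ne_zero psi ^ 4 := by
  have h := congrArg (expand 2 two_ne_zero) psi_sq
  rw [map_mul, map_pow, expand_expand two_ne_zero two_ne_zero four_ne_zero rfl] at h
  have h1 : expand 2 two_ne_zero psi ^ 4 =
      (expand 2 two_ne_zero phi * expand 4 four_ne_zero psi) ^ 2 := by rw [← h]; ring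
  rw [show phi ^ 4 - evalNegHom phi ^ 4 = (phi ^ 2) ^ 2 - (evalNegHom phi ^ 2) ^ 2 by ring, h1,
    phi_sq, evalNegHom_phi_sq]
  ring

/-- The series `∑ a(k n + r) q^n` extracted from `∑ a(n) q^n`. -/
noncomputable def dissect (k r : ℕ) : ℤ⟦X⟧ →+ ℤ⟦X⟧ where
  toFun F := PowerSeries.mk fun n => coeff (k * n + r) F
  map_zero' := by ext n; simp
  map_add' F G := by ext n; simp

theorem coeff_dissect (k r n : ℕ) (F : ℤ⟦X⟧) :
    coeff n (dissect k r F) = coeff (k * n + r) F := by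
  simp [dissect]

theorem dissect_mul_expand {k r : ℕ} (hk : k ≠ 0) (hr : r < k) (F G : ℤ⟦X⟧) :
    dissect k r (F * expand k hk G) = dissect k r F * G := by
  ext n
  rw [coeff_dissect, coeff_mul, coeff_mul]
  symm
  refine sum_of_injOn (fun p => (k * p.1 + r, k * p.2)) ?_ ?_ ?_ ?_
  · rintro ⟨i, j⟩ _ ⟨i', j'⟩ _ h
    simpa [hk] using h
  · rintro ⟨i, j⟩ h
    simp only [mem_coe, HasAntidiagonal.mem_antidiagonal] at h ⊢
    rw [← h]
    ring
  · rintro ⟨i, j⟩ h hn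
    rw [coeff_expand, if_neg, mul_zero]
    rintro ⟨j', rfl⟩
    rw [HasAntidiagonal.mem_antidiagonal] at h
    simp only at h
    refine hn ⟨(n - j', j'), ?_, ?_⟩
    · have : k * j' < k * (n + 1) := by rw [mul_add]; omega
      have := Nat.lt_of_mul_lt_mul_left this
      simp only [mem_coe, HasAntidiagonal.mem_antidiagonal]
      omega
    · have : k * j' < k * (n + 1) := by rw [mul_add]; omega
      have := Nat.lt_of_mul_lt_mul_left this
      obtain ⟨m, rfl⟩ := Nat.exists_eq_add_of_le (Nat.le_of_lt_succ this)
      simp only [Nat.add_sub_cancel_left, Prod.mk.injEq, and_true]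
      rw [mul_add] at h
      omega
  · rintro ⟨i, j⟩ _
    rw [coeff_dissect, coeff_expand_mul]

theorem dissect_X_pow_mul_expand {k r : ℕ} (hk : k ≠ 0) (hr : r < k) (G : ℤ⟦X⟧) :
    dissect k r (X ^ r * expand k hk G) = G := by
  rw [dissect_mul_expand hk hr]
  convert one_mul G
  ext n
  rw [coeff_dissect, coeff_X_pow, coeff_one]
  simp [hk]

theorem dissect_X_pow_mul_expand_of_ne {k r s d : ℕ} (hd : d ≠ 0) (hdk : d ∣ k)
    (h : ¬ s ≡ r [MOD d]) (G : ℤ⟦X⟧) : dissect k r (X ^ s * expand d hd G) = 0 := by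
  ext n
  rw [coeff_dissect, coeff_X_pow_mul', map_zero]
  split_ifs with hs
  · rw [coeff_expand, if_neg]
    intro h1
    apply h
    have h2 := (Nat.modEq_iff_dvd' hs).mpr h1
    refine h2.trans ?_
    obtain ⟨e, rfl⟩ := hdk
    rw [mul_assoc]
    simp [Nat.ModEq]
  · rfl

/-- The generating function of the numbers `v0 (4 n)`. -/
noncomputable def v0Four : ℤ⟦X⟧ := PowerSeries.mk fun n => v0 (4 * n)

/-- The generating function of the numbers `v0 (32 n + 4)`. -/
noncomputable def v0ThirtyTwo : ℤ⟦X⟧ := PowerSeries.mk fun n => v0 (32 * n + 4)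

theorem v0Four_mul_evalNegHom_phi : (2 * v0Four - 1) * evalNegHom phi = phi ^ 2 := by
  have h := congrArg (dissect 2 0) v0Even_mul_evalNegHom_phi
  have h1 : phi ^ 2 = X ^ 0 * expand 2 two_ne_zero (phi ^ 2) +
      X ^ 1 * expand 2 two_ne_zero (4 * expand 2 two_ne_zero psi ^ 2) := by
    simp only [map_mul, map_pow, map_ofNat,
      expand_expand two_ne_zero two_ne_zero four_ne_zero rfl]
    linear_combination phi_sq
  have h2 : dissect 2 0 (2 * v0Even - 1) = 2 * v0Four - 1 := by
    have h3 : dissect 2 0 v0Even = v0Four := by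
      ext n
      rw [coeff_dissect, v0Even, v0Four, coeff_mk, coeff_mk]
      congr 1
      ring
    have h4 : dissect 2 0 1 = 1 := by
      ext n
      rw [coeff_dissect, coeff_one, coeff_one]
      simp
    rw [map_sub, two_mul, map_add, h3, h4, two_mul]
  rw [dissect_mul_expand two_ne_zero two_pos, h2, h1, map_add,
    dissect_X_pow_mul_expand two_ne_zero two_pos,
    dissect_X_pow_mul_expand_of_ne two_ne_zero dvd_rfl (by decide), add_zero] at h
  exact h

/-- Iterating φ(q) φ(-q) = φ(-q²)² gives 1/φ(-q) = φ(q) φ(q²)² φ(q⁴)⁴ / φ(-q⁸)⁸, whose denominator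
passes through an 8-dissection. -/
theorem v0Four_mul_expand : (2 * v0Four - 1) * expand 8 (by norm_num) (evalNegHom phi ^ 8) =
    phi ^ 3 * expand 2 two_ne_zero phi ^ 2 * expand 4 four_ne_zero phi ^ 4 := by
  have h1 := phi_mul_evalNegHom_phi
  have h2 := congrArg (expand 2 two_ne_zero) h1
  have h3 := congrArg (expand 4 four_ne_zero) h1
  simp only [map_mul, map_pow, expand_expand two_ne_zero two_ne_zero four_ne_zero rfl,
    expand_expand four_ne_zero two_ne_zero (show 8 ≠ 0 by norm_num) rfl] at h2 h3
  rw [map_pow]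
  set N2 := expand 2 two_ne_zero (evalNegHom phi)
  set N4 := expand 4 four_ne_zero (evalNegHom phi)
  set N8 := expand 8 (by norm_num) (evalNegHom phi)
  set P2 := expand 2 two_ne_zero phi
  set P4 := expand 4 four_ne_zero phi
  calc (2 * v0Four - 1) * N8 ^ 8 = (2 * v0Four - 1) * (N8 ^ 2) ^ 4 := by ring
    _ = (2 * v0Four - 1) * P4 ^ 4 * (N4 ^ 2) ^ 2 := by rw [← h3]; ring
    _ = (2 * v0Four - 1) * P4 ^ 4 * P2 ^ 2 * N2 ^ 2 := by rw [← h2]; ring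
    _ = (2 * v0Four - 1) * evalNegHom phi * P4 ^ 4 * P2 ^ 2 * phi := by rw [← h1]; ring
    _ = phi ^ 3 * P2 ^ 2 * P4 ^ 4 := by rw [v0Four_mul_evalNegHom_phi]; ring

theorem phi_pow_dissection :
    phi ^ 3 * expand 2 two_ne_zero phi ^ 2 * expand 4 four_ne_zero phi ^ 4 =
      X ^ 0 * expand 4 four_ne_zero (phi ^ 9) +
      X ^ 2 * expand 4 four_ne_zero (16 * phi ^ 7 * expand 2 two_ne_zero psi ^ 2) +
      X ^ 3 * expand 4 four_ne_zero (32 * phi ^ 6 * expand 2 two_ne_zero psi ^ 3) +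
      X ^ 4 * expand 4 four_ne_zero (48 * phi ^ 5 * expand 2 two_ne_zero psi ^ 4) +
      X ^ 1 * expand 8 (by norm_num) (2 * psi * (3 * phi ^ 8 +
        416 * X * phi ^ 4 * expand 2 two_ne_zero psi ^ 4 +
        768 * X ^ 2 * expand 2 two_ne_zero psi ^ 8)) +
      X ^ 5 * expand 8 (by norm_num) (2 * psi * (64 * phi ^ 6 * expand 2 two_ne_zero psi ^ 2 +
        1024 * X * phi ^ 2 * expand 2 two_ne_zero psi ^ 6)) := by
  have h1 := phi_dissection
  have h2 := phi_sq
  have h3 := congrArg (expand 4 four_ne_zero) psi_sq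
  have h4 := congrArg (expand 4 four_ne_zero) phi_sq
  have h5 := congrArg (expand 8 (by norm_num)) psi_sq
  simp only [map_mul, map_pow, map_add, map_ofNat, expand_X,
    expand_expand four_ne_zero two_ne_zero (show 8 ≠ 0 by norm_num) rfl,
    expand_expand four_ne_zero four_ne_zero (show 16 ≠ 0 by norm_num) rfl,
    expand_expand (show 8 ≠ 0 by norm_num) two_ne_zero (show 16 ≠ 0 by norm_num) rfl]
    at h3 h4 h5 ⊢
  set a := expand 4 four_ne_zero phi
  set b := expand 8 (by norm_num) psi
  set c := expand 8 (by norm_num) phi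
  set d := expand 16 (by norm_num) psi
  have h6 : expand 2 two_ne_zero phi ^ 2 = a ^ 2 + 4 * X ^ 2 * b ^ 2 := by
    rw [h3] at h2
    linear_combination -h2 + (phi + a + 2 * X * b) * h1
  have h8 : b ^ 4 = c ^ 2 * d ^ 2 := by rw [← mul_pow, ← h5]; ring
  have h9 : a ^ 4 = (c ^ 2 + 4 * X ^ 4 * d ^ 2) ^ 2 := by
    rw [← h4]; ring
  rw [h6, h1]
  -- Expand (a + 2qb)³ (a² + 4q²b²) a⁴. Only the class 1 mod 4 has to be split modulo 8; it involves
  -- a only through a⁴, and b⁴ = c²d².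
  calc _ = a ^ 9 + X ^ 2 * (16 * a ^ 7 * b ^ 2) + X ^ 3 * (32 * a ^ 6 * b ^ 3) +
        X ^ 4 * (48 * a ^ 5 * b ^ 4) +
        2 * X * b * (3 * (a ^ 4) ^ 2 + 16 * X ^ 4 * a ^ 4 * b ^ 4) := by ring
    _ = _ := by rw [h9, h8]; ring

theorem v0ThirtyTwo_mul_evalNegHom_phi_pow :
    v0ThirtyTwo * evalNegHom phi ^ 8 = psi * (3 * phi ^ 8 +
      416 * X * phi ^ 4 * expand 2 two_ne_zero psi ^ 4 +
      768 * X ^ 2 * expand 2 two_ne_zero psi ^ 8) := by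
  have h := congrArg (dissect 8 1) v0Four_mul_expand
  have h2 : dissect 8 1 (2 * v0Four - 1) = 2 * v0ThirtyTwo := by
    have h3 : dissect 8 1 v0Four = v0ThirtyTwo := by
      ext n
      rw [coeff_dissect, v0Four, v0ThirtyTwo, coeff_mk, coeff_mk]
      congr 1
      ring
    have h4 : dissect 8 1 1 = 0 := by
      ext n
      rw [coeff_dissect, coeff_one]
      simp
    rw [map_sub, two_mul, map_add, h3, h4, two_mul, sub_zero]
  rw [dissect_mul_expand (by norm_num) (by norm_num), h2, phi_pow_dissection] at h
  simp only [map_add] at h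
  rw [dissect_X_pow_mul_expand_of_ne four_ne_zero (by decide) (by decide),
    dissect_X_pow_mul_expand_of_ne four_ne_zero (by decide) (by decide),
    dissect_X_pow_mul_expand_of_ne four_ne_zero (by decide) (by decide),
    dissect_X_pow_mul_expand_of_ne four_ne_zero (by decide) (by decide),
    dissect_X_pow_mul_expand (by norm_num) (by norm_num),
    dissect_X_pow_mul_expand_of_ne (by norm_num) (by decide) (by decide)] at h
  have h0 : (2 : ℤ⟦X⟧) ≠ 0 := fun h0 => by
    have := congrArg constantCoeff h0
    rw [map_ofNat, map_zero] at this
    exact two_ne_zero this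
  apply mul_left_cancel₀ h0
  linear_combination h

/-- The factor φ(-q)^5 raises the denominator φ(-q)^8 to a 13th power; the numerator then becomes
E(q) times a 13th power. -/
theorem phi_mul_psi_eq_euler :
    phi ^ 4 * expand 2 two_ne_zero psi ^ 4 * evalNegHom phi ^ 5 * psi =
      euler * expand 2 two_ne_zero euler ^ 13 := by
  have h1 := evalNegHom_phi_mul_expand_euler
  have h2 := psi_mul_euler
  have h3 := congrArg (expand 2 two_ne_zero) h1
  have h4 := congrArg (expand 2 two_ne_zero) h2
  have h5 := phi_mul_evalNegHom_phi
  have hne : euler * expand 2 two_ne_zero euler ^ 5 *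
      expand 2 two_ne_zero (expand 2 two_ne_zero euler) ^ 8 ≠ 0 := by
    have := euler_ne_zero
    exact mul_ne_zero (mul_ne_zero this (pow_ne_zero _ (expand_ne_zero this _ _)))
      (pow_ne_zero _ (expand_ne_zero (expand_ne_zero this _ _) _ _))
  apply mul_left_cancel₀ hne
  simp only [map_mul, map_pow] at h3 h4
  set E2 := expand 2 two_ne_zero euler
  set E4 := expand 2 two_ne_zero E2
  set N2 := expand 2 two_ne_zero (evalNegHom phi)
  set psi2 := expand 2 two_ne_zero psi
  calc _ = (phi * evalNegHom phi) ^ 4 * E4 ^ 8 * (psi2 * E2) ^ 4 * (evalNegHom phi * E2) *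
        (psi * euler) := by ring
    _ = (N2 * E4) ^ 8 * (psi2 * E2) ^ 4 * (evalNegHom phi * E2) * (psi * euler) := by
        rw [h5]; ring
    _ = _ := by rw [h1, h2, h3, h4]; ring

theorem v0ThirtyTwo_mul : v0ThirtyTwo * evalNegHom phi ^ 13 =
    3 * psi * evalNegHom phi ^ 13 + 512 * X * euler * expand 2 two_ne_zero euler ^ 13 := by
  -- With A = φ(q)⁴, B = φ(-q)⁴ and y = 16qψ(q²)⁴ = A - B, the bracket is 3A² + 26Ay + 3y² = 3B² +
  -- 32Ay.
  linear_combination evalNegHom phi ^ 5 * v0ThirtyTwo_mul_evalNegHom_phi_pow +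
    512 * X * phi_mul_psi_eq_euler + 3 * psi * evalNegHom phi ^ 5 *
      (phi ^ 4 - evalNegHom phi ^ 4 - 16 * X * expand 2 two_ne_zero psi ^ 4 +
        2 * evalNegHom phi ^ 4) * phi_pow_four_sub

/-! ### The congruence modulo 13 -/

theorem pow_thirteen_eq_expand (F : (ZMod 13)⟦X⟧) : F ^ 13 = expand 13 (by norm_num) F := by
  have : Fact (Nat.Prime 13) := ⟨by norm_num⟩
  have h := MvPowerSeries.map_frobenius_expand (R := ZMod 13) (σ := Unit) 13 (by norm_num) (f := F)
  rw [ZMod.frobenius_zmod] at h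
  rw [← h, MvPowerSeries.map_id]
  rfl

theorem constantCoeff_phi : constantCoeff phi = 1 := by
  have h := (WithPiTopology.hasSum_iff_hasSum_coeff _).mp
    thetaExponent_sqExp.hasSum_thetaSeries 0
  rw [← coeff_zero_eq_constantCoeff_apply]
  refine (h.congr_fun (g := fun t : ℤ => if t = 0 then 1 else 0) fun t => ?_).unique
    (hasSum_ite_eq 0 1)
  rw [coeff_X_pow]
  simp [sqExp, eq_comm (a := 0)]

theorem coeff_psi_eq_zero {n : ℕ} (hn : ∀ t, triExp t ≠ n) : coeff n psi = 0 := by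
  have h := (WithPiTopology.hasSum_iff_hasSum_coeff _).mp
    thetaExponent_triExp.hasSum_thetaSeries n
  have h1 : HasSum (fun _ : ℤ => (0 : ℤ)) (coeff n (thetaSeries triExp)) :=
    h.congr_fun fun t => by rw [coeff_X_pow, if_neg (hn t).symm]
  have h2 := h1.unique hasSum_zero
  rw [thetaSeries_triExp, two_mul, map_add] at h2
  omega

theorem exists_v0ThirtyTwo_eq : ∃ H : (ZMod 13)⟦X⟧,
    map (Int.castRingHom (ZMod 13)) v0ThirtyTwo =
      3 * map (Int.castRingHom (ZMod 13)) psi +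
        X * (512 * map (Int.castRingHom (ZMod 13)) euler) * expand 13 (by norm_num) H := by
  set f := PowerSeries.map (Int.castRingHom (ZMod 13))
  have h := congrArg f v0ThirtyTwo_mul
  simp only [map_mul, map_add, map_pow, map_ofNat, pow_thirteen_eq_expand] at h
  have hX : f X = X := map_X _
  rw [hX] at h
  have hI : f (evalNegHom phi) * invOfUnit (f (evalNegHom phi)) 1 = 1 := by
    refine mul_invOfUnit _ _ ?_
    rw [← coeff_zero_eq_constantCoeff_apply, coeff_map, evalNegHom, coeff_rescale, pow_zero,
      one_mul, coeff_zero_eq_constantCoeff_apply, constantCoeff_phi]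
    simp
  refine ⟨f (expand 2 two_ne_zero euler) * invOfUnit (f (evalNegHom phi)) 1, ?_⟩
  have hJ := congrArg (expand 13 (by norm_num)) hI
  rw [map_mul, map_one] at hJ
  rw [map_mul]
  linear_combination expand 13 (by norm_num) (invOfUnit (f (evalNegHom phi)) 1) * h -
    (f v0ThirtyTwo - 3 * f psi) * hJ

theorem coeff_v0ThirtyTwo {n : ℕ} (hn : ∀ s : ZMod 13, s ^ 2 ≠ 8 * n + 1) :
    coeff n (map (Int.castRingHom (ZMod 13)) v0ThirtyTwo) = 0 := by
  obtain ⟨H, hH⟩ := exists_v0ThirtyTwo_eq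
  have h13 : (13 : ZMod 13) = 0 := rfl
  have h3 : ∀ s : ZMod 13, s ^ 2 ≠ 3 * (8 * n + 1) := by
    intro s hs
    -- 10² = 100 ≡ 9 is the inverse of 3 modulo 13.
    refine hn (s * 10) ?_
    linear_combination 100 * hs + 23 * (8 * n + 1) * h13
  have hpsi : coeff n psi = 0 := by
    refine coeff_psi_eq_zero fun t ht => hn (2 * t - 1) ?_
    have h := congrArg (Int.cast (R := ZMod 13)) (two_mul_natCast_triExp t)
    rw [ht] at h
    push_cast at h
    linear_combination -4 * h
  rw [hH, map_add, ← map_ofNat (C (R := ZMod 13)) 3, coeff_C_mul, coeff_map, hpsi, map_zero,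
    mul_zero, zero_add, coeff_mul]
  refine sum_eq_zero fun p hp => ?_
  rw [HasAntidiagonal.mem_antidiagonal] at hp
  rw [coeff_expand]
  split_ifs with hd
  · obtain ⟨m, hm⟩ := hd
    rcases hi : p.1 with _ | i
    · simp
    · rw [coeff_succ_X_mul, ← map_ofNat (C (R := ZMod 13)) 512, coeff_C_mul, coeff_map, euler,
        coeff_pentagonalSeries_eq_zero]
      · simp
      · rintro ⟨k, hk⟩
        -- 24 · k(3k - 1)/2 + 1 = (6k - 1)², and n ≡ k(3k - 1)/2 + 1, the shift coming from the
        -- factor q.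
        refine h3 (6 * k - 1) ?_
        have h := congrArg (Int.cast (R := ZMod 13)) (two_mul_natCast_pentagonal k)
        have hn' : n = i + 1 + 13 * m := by omega
        rw [hk] at h
        rw [hn']
        push_cast at h ⊢
        linear_combination -12 * h - (2 + 24 * m) * h13
  · simp

end EighthOrderMockTheta


theorem mainTheorem7 (n r : ℕ) (hr : r ∈ ({132, 164, 228, 292, 356, 388} : Finset ℕ)) :
    v0 (416 * n + r) ≡ 0 [ZMOD 13] := by
  obtain ⟨m, rfl, hm⟩ : ∃ m, r = 32 * m + 4 ∧ ∀ s : ZMod 13, s ^ 2 ≠ 8 * m + 1 := by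
    simp only [Finset.mem_insert, Finset.mem_singleton] at hr
    rcases hr with rfl | rfl | rfl | rfl | rfl | rfl
    exacts [⟨4, rfl, by decide⟩, ⟨5, rfl, by decide⟩, ⟨7, rfl, by decide⟩, ⟨9, rfl, by decide⟩,
      ⟨11, rfl, by decide⟩, ⟨12, rfl, by decide⟩]
  have h := EighthOrderMockTheta.coeff_v0ThirtyTwo (n := 13 * n + m) fun s hs => hm s <| by
    rw [hs]
    push_cast
    reduce_mod_char
  rw [PowerSeries.coeff_map, EighthOrderMockTheta.v0ThirtyTwo, PowerSeries.coeff_mk,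
    show 32 * (13 * n + m) + 4 = 416 * n + (32 * m + 4) by ring] at h
  exact (ZMod.intCast_eq_intCast_iff _ _ 13).mp (by simpa using h)
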